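/- Write $|\cdot|$ for the Euclidean norm on $\mathbb R^d$ and $S=\{\xi\in\mathbb R^d:|\xi|=1\}$. Every infinitely divisible distribution $\mu$ on $\mathbb R^d$ has a unique generating triplet $(A,\nu,\gamma)$, with $A$ a symmetric nonnegative-definite $d\times d$ matrix, $\gamma\in\mathbb R^d$ and $\nu$ (the Lévy measure) a measure on $\mathbb R^d$ with $\nu(\{0\})=0$ and $\int(|x|^2\wedge 1)\,\nu(dx)<\infty$, such that $$\widehat\mu(z)=\exp\Big\{-\tfrac12\langle z,Az\rangle+\mathrm i\langle\gamma,z\rangle+\int_{\mathbb R^d}\Big(e^{\mathrm i\langle z,x\rangle}-1-\frac{\mathrm i\langle z,x\rangle}{1+|x|^2}\Big)\nu(dx)\Big\},\quad z\in\mathbb R^d.$$ If $\nu\neq0$, a polar decomposition $(\lambda,\nu_\xi)$ of $\nu$ consists of a measure $\lambda$ on $S$ with $0<\lambda(S)\le\infty$ and measures $\nu_\xi$, $\xi\in S$, on $(0,\infty)$ with $0<\nu_\xi((0,\infty))\le\infty$, such that $\nu_\xi(B)$ is measurable in $\xi$ for each Borel set $B\subset(0,\infty)$ and $$\nu(B)=\int_S\lambda(d\xi)\int_0^\infty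 1_B(r\xi)\,\nu_\xi(dr)\quad\text{for all Borel sets } B\subset\mathbb R^d\setminus\{0\}.$$ A function $g$ on $(0,\infty)$ is completely monotone if it is $C^\infty$ and $(-1)^n g^{(n)}\ge0$ on $(0,\infty)$ for all $n\ge0$. For $\alpha>0$, let $E_\alpha(\mathbb R^d)$ be the class of all infinitely divisible distributions $\mu$ on $\mathbb R^d$ whose Lévy measure $\nu$ either is zero or is nonzero and has a polar decomposition $(\lambda,\nu_\xi)$ with $$\nu_\xi(dr)=r^{\alpha-1}g_\xi(r^\alpha)\,dr,\quad r>0,\qquad\text{for }\lambda\text{-a.e. }\xi,$$ for some functions $g_\xi(r)$ that are completely monotone in $r\in(0,\infty)$ for $\lambda$-a.e. $\xi$, are measurable in $\xi$ for each $r>0$, and satisfy $\int_0^\infty(r^{\alpha+1}\wedge r^{\alpha-1})\,g_\xi(r^\alpha)\,dr<\infty$ for $\lambda$-a.e. $\xi$. Theorem. For any $0<\alpha<\beta$, $$E_\alpha(\mathbb R^d)\subseteq E_\beta(\mathbb R^d).$$ -/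

import Mathlib

open MeasureTheory ProbabilityTheory
open scoped ENNReal ContDiff

noncomputable section

namespace InfDiv

/-- The space `ℝ^d` with its Euclidean norm. -/
abbrev Euc (d : ℕ) : Type := EuclideanSpace ℝ (Fin d)

/-- The unit sphere `S = {ξ ∈ ℝ^d : |ξ| = 1}`. -/
abbrev USphere (d : ℕ) : Type := Metric.sphere (0 : Euc d) 1

/-- The `n`-fold convolution power of a measure on `ℝ^d`. -/
def convPow {d : ℕ} (ρ : Measure (Euc d)) : ℕ → Measure (Euc d)
  | 0 => Measure.dirac 0
  | n + 1 => (convPow ρ n).conv ρ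

/-- `μ` is an infinitely divisible probability distribution on `ℝ^d`. -/
def IsInfinitelyDivisible {d : ℕ} (μ : Measure (Euc d)) : Prop :=
  IsProbabilityMeasure μ ∧
    ∀ n : ℕ, 1 ≤ n → ∃ ρ : Measure (Euc d), IsProbabilityMeasure ρ ∧ convPow ρ n = μ

/-- `ν` is a Lévy measure on `ℝ^d`: `ν({0}) = 0` and `∫ (|x|² ∧ 1) ν(dx) < ∞`. -/
def IsLevyMeasure {d : ℕ} (ν : Measure (Euc d)) : Prop :=
  ν {0} = 0 ∧ ∫⁻ x, ENNReal.ofReal (min (‖x‖ ^ 2) 1) ∂ν < ⊤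

/-- The Lévy–Khintchine exponent
`-½⟨z, Az⟩ + i⟨γ, z⟩ + ∫ (e^{i⟨z,x⟩} - 1 - i⟨z,x⟩ (1+|x|²)⁻¹) ν(dx)`. -/
def levyExponent {d : ℕ} (A : Matrix (Fin d) (Fin d) ℝ) (ν : Measure (Euc d)) (γ z : Euc d) : ℂ :=
  -(2 : ℂ)⁻¹ * ((inner ℝ z (A.toEuclideanLin z) : ℝ) : ℂ)
    + Complex.I * ((inner ℝ γ z : ℝ) : ℂ)
    + ∫ x, (Complex.exp (Complex.I * ((inner ℝ z x : ℝ) : ℂ)) - 1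
        - Complex.I * ((inner ℝ z x : ℝ) : ℂ) * (((1 + ‖x‖ ^ 2)⁻¹ : ℝ) : ℂ)) ∂ν

/-- `(A, ν, γ)` is the generating triplet of `μ`. -/
def HasGeneratingTriplet {d : ℕ} (μ : Measure (Euc d))
    (A : Matrix (Fin d) (Fin d) ℝ) (ν : Measure (Euc d)) (γ : Euc d) : Prop :=
  A.PosSemidef ∧ IsLevyMeasure ν ∧
    ∀ z : Euc d, charFun μ z = Complex.exp (levyExponent A ν γ z)

/-- `(lam, κ)` is a polar decomposition of the measure `ν ≠ 0` on `ℝ^d`: `lam` is a nonzero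
(possibly infinite) measure on the sphere, `κ ξ` is a nonzero (possibly infinite) measure on
`(0,∞)` depending measurably on `ξ` (this is the meaning of `Kernel`), and
`ν(B) = ∫_S lam(dξ) ∫_0^∞ 1_B(rξ) κ_ξ(dr)` for Borel `B ⊆ ℝ^d ∖ {0}`. -/
def IsPolarDecomposition {d : ℕ} (ν : Measure (Euc d)) (lam : Measure (USphere d))
    (κ : Kernel (USphere d) (Set.Ioi (0 : ℝ))) : Prop :=
  0 < lam Set.univ ∧ (∀ ξ, 0 < κ ξ Set.univ) ∧
    ∀ B : Set (Euc d), MeasurableSet B → (0 : Euc d) ∉ B →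
      ν B = ∫⁻ ξ, ∫⁻ r, B.indicator (fun _ => (1 : ℝ≥0∞)) ((r : ℝ) • (ξ : Euc d)) ∂(κ ξ) ∂lam

/-- `g` is completely monotone on `(0,∞)`: it is `C^∞` there and `(-1)^n g^{(n)} ≥ 0` for all
`n ≥ 0`. Values of `g` outside `(0,∞)` play no role. -/
def IsCompletelyMonotone (g : ℝ → ℝ) : Prop :=
  ContDiffOn ℝ ∞ g (Set.Ioi 0) ∧
    ∀ n : ℕ, ∀ x : ℝ, 0 < x → 0 ≤ (-1) ^ n * iteratedDerivWithin n g (Set.Ioi 0) x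

/-- The radial components `κ_ξ` have, for `lam`-a.e. `ξ`, the form
`κ_ξ(dr) = r^{α-1} g_ξ(r^α) dr` with `g_ξ(r)` completely monotone in `r` for `lam`-a.e. `ξ`,
measurable in `ξ` for each `r > 0`, and
`∫_0^∞ (r^{α+1} ∧ r^{α-1}) g_ξ(r^α) dr < ∞` for `lam`-a.e. `ξ`. -/
def HasRadialForm {d : ℕ} (α : ℝ) (lam : Measure (USphere d))
    (κ : Kernel (USphere d) (Set.Ioi (0 : ℝ))) : Prop :=
  ∃ g : USphere d → ℝ → ℝ,
    (∀ r : ℝ, 0 < r → Measurable fun ξ => g ξ r) ∧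
    (∀ᵐ ξ ∂lam, IsCompletelyMonotone (g ξ)) ∧
    (∀ᵐ ξ ∂lam, κ ξ = (Measure.comap (Subtype.val : Set.Ioi (0 : ℝ) → ℝ) volume).withDensity
      fun r => ENNReal.ofReal ((r : ℝ) ^ (α - 1) * g ξ ((r : ℝ) ^ α))) ∧
    (∀ᵐ ξ ∂lam, ∫⁻ r in Set.Ioi (0 : ℝ),
      ENNReal.ofReal (min (r ^ (α + 1)) (r ^ (α - 1)) * g ξ (r ^ α)) < ⊤)

/-- The class `E_α(ℝ^d)`: the infinitely divisible `μ` whose Lévy measure `ν` is zero, or is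
nonzero and has a polar decomposition with radial components of the above form. -/
def classE (α : ℝ) (d : ℕ) : Set (Measure (Euc d)) :=
  {μ | IsInfinitelyDivisible μ ∧
    ∃ (A : Matrix (Fin d) (Fin d) ℝ) (ν : Measure (Euc d)) (γ : Euc d),
      HasGeneratingTriplet μ A ν γ ∧
      (ν = 0 ∨ (ν ≠ 0 ∧
        ∃ (lam : Measure (USphere d)) (κ : Kernel (USphere d) (Set.Ioi (0 : ℝ))),
          IsPolarDecomposition ν lam κ ∧ HasRadialForm α lam κ))}

end InfDiv

end

open MeasureTheory ProbabilityTheory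
open scoped ENNReal ContDiff

namespace InfDiv

/-! The triplet and the polar decomposition stay the same; only the density is rewritten. With
`h_ξ(s) = s^{-(1-α/β)} g_ξ(s^{α/β})` one has `r^{β-1} h_ξ(r^β) = r^{α-1} g_ξ(r^α)`, so all that
needs proof is that `h_ξ` is completely monotone. This holds because the functions `s^{-p} g(s^q)`,
with `g` completely monotone, `p ≥ 0` and fixed `q ∈ [0,1]`, are nonnegative and minus the
derivative of one is a nonnegative combination of two others. -/

/-- The negative of the derivative of a completely monotone function is completely monotone. -/
theorem IsCompletelyMonotone.neg_derivWithin {g : ℝ → ℝ} (hg : IsCompletelyMonotone g) :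
    IsCompletelyMonotone (fun x => -derivWithin g (Set.Ioi 0) x) := by
  refine ⟨(hg.1.derivWithin (uniqueDiffOn_Ioi 0) (by simp)).neg, fun n x hx => ?_⟩
  have h := hg.2 (n + 1) x hx
  rw [iteratedDerivWithin_succ'] at h
  rw [iteratedDerivWithin_fun_neg]
  calc (0 : ℝ) ≤ _ := h
    _ = _ := by ring

theorem contDiffOn_rpow_const_Ioi (p : ℝ) :
    ContDiffOn ℝ ∞ (fun s : ℝ => s ^ p) (Set.Ioi 0) :=
  contDiffOn_id.rpow_const_of_ne fun _ hs => ne_of_gt hs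

theorem contDiffOn_rpow_mul_comp_rpow {g : ℝ → ℝ} (hg : ContDiffOn ℝ ∞ g (Set.Ioi 0))
    (p q : ℝ) : ContDiffOn ℝ ∞ (fun s : ℝ => s ^ p * g (s ^ q)) (Set.Ioi 0) :=
  (contDiffOn_rpow_const_Ioi p).mul
    (hg.comp (contDiffOn_rpow_const_Ioi q) fun _ hs => Real.rpow_pos_of_pos hs q)

theorem derivWithin_rpow_mul_comp_rpow {g : ℝ → ℝ} (hg : DifferentiableOn ℝ g (Set.Ioi 0))
    (p q : ℝ) {s : ℝ} (hs : 0 < s) :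
    derivWithin (fun s : ℝ => s ^ (-p) * g (s ^ q)) (Set.Ioi 0) s =
      -(p * (s ^ (-(p + 1)) * g (s ^ q)) +
        q * (s ^ (-(p + (1 - q))) * -derivWithin g (Set.Ioi 0) (s ^ q))) := by
  have hsq : 0 < s ^ q := Real.rpow_pos_of_pos hs q
  have hg' : HasDerivAt g (derivWithin g (Set.Ioi 0) (s ^ q)) (s ^ q) :=
    ((hg _ hsq).hasDerivWithinAt).hasDerivAt (Ioi_mem_nhds hsq)
  have h := ((Real.hasDerivAt_rpow_const (p := -p) (Or.inl hs.ne')).mul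
    (hg'.comp s (Real.hasDerivAt_rpow_const (p := q) (Or.inl hs.ne')))).hasDerivWithinAt
      (s := Set.Ioi 0)
  refine (h.derivWithin (uniqueDiffOn_Ioi 0 s hs)).trans ?_
  have e1 : s ^ (-(p + 1)) = s ^ (-p - 1) := by ring_nf
  have e2 : s ^ (-(p + (1 - q))) = s ^ (-p) * s ^ (q - 1) := by
    rw [← Real.rpow_add hs]; ring_nf
  rw [e1, e2]
  simp only [Function.comp]
  ring

/-- If `g` is completely monotone, `p ≥ 0` and `0 ≤ q ≤ 1`, then `s ↦ s^{-p} g(s^q)` is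
completely monotone. -/
theorem IsCompletelyMonotone.rpow_mul_comp_rpow {g : ℝ → ℝ} (hg : IsCompletelyMonotone g)
    {p q : ℝ} (hp : 0 ≤ p) (hq : 0 ≤ q) (hq1 : q ≤ 1) :
    IsCompletelyMonotone (fun s => s ^ (-p) * g (s ^ q)) := by
  refine ⟨contDiffOn_rpow_mul_comp_rpow hg.1 _ _, fun n => ?_⟩
  -- Differentiation turns `(p, g)` into `(p + 1, g)` and `(p + 1 - q, -g')`, so both must vary; `q
  -- ≤ 1` keeps the second exponent nonnegative.
  induction n generalizing g p with
  | zero =>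
    intro x hx
    have h := hg.2 0 (x ^ q) (Real.rpow_pos_of_pos hx q)
    simp only [pow_zero, one_mul, iteratedDerivWithin_zero] at h ⊢
    exact mul_nonneg (Real.rpow_nonneg hx.le _) h
  | succ n ih =>
    intro x hx
    have hu := uniqueDiffOn_Ioi (0 : ℝ)
    have hx' : x ∈ Set.Ioi (0 : ℝ) := hx
    have c1 := (contDiffOn_rpow_mul_comp_rpow hg.1 (-(p + 1)) q x hx).of_le
      (m := n) (mod_cast le_top)
    have c2 := (contDiffOn_rpow_mul_comp_rpow hg.neg_derivWithin.1 (-(p + (1 - q))) q x hx).of_le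
      (m := n) (mod_cast le_top)
    have h1 := ih hg (p := p + 1) (by linarith) x hx
    have h2 := ih hg.neg_derivWithin (p := p + (1 - q)) (by linarith) x hx
    have hd : Set.EqOn (derivWithin (fun s : ℝ => s ^ (-p) * g (s ^ q)) (Set.Ioi 0)) _
        (Set.Ioi 0) := fun s hs =>
      derivWithin_rpow_mul_comp_rpow (hg.1.differentiableOn (by simp)) p q hs
    rw [iteratedDerivWithin_succ', iteratedDerivWithin_congr hd hx',
      iteratedDerivWithin_fun_neg,
      iteratedDerivWithin_fun_add hx' hu (contDiffWithinAt_const.mul c1)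
        (contDiffWithinAt_const.mul c2),
      iteratedDerivWithin_const_mul hx' hu p c1, iteratedDerivWithin_const_mul hx' hu q c2]
    calc (0 : ℝ) ≤ _ := add_nonneg (mul_nonneg hp h1) (mul_nonneg hq h2)
      _ = _ := by ring

theorem HasRadialForm.mono {d : ℕ} {α β : ℝ} (hα : 0 < α) (hαβ : α ≤ β)
    {lam : Measure (USphere d)} {κ : Kernel (USphere d) (Set.Ioi (0 : ℝ))}
    (h : HasRadialForm α lam κ) : HasRadialForm β lam κ := by
  obtain ⟨g, hmeas, hcm, hκ, hint⟩ := h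
  have hβ : 0 < β := hα.trans_le hαβ
  have hq1 : α / β ≤ 1 := (div_le_one hβ).2 hαβ
  -- The new function at `s = r^β`: the factor `r^{α-β}` converts every weight for `β` into that for
  -- `α`.
  have hgr : ∀ ξ, ∀ r : ℝ, 0 < r →
      (r ^ β) ^ (-(1 - α / β)) * g ξ ((r ^ β) ^ (α / β)) = r ^ (α - β) * g ξ (r ^ α) := by
    intro ξ r hr
    have e1 : β * -(1 - α / β) = α - β := by field_simp; ring
    have e2 : β * (α / β) = α := by field_simp
    rw [← Real.rpow_mul hr.le, ← Real.rpow_mul hr.le, e1, e2]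
  refine ⟨fun ξ s => s ^ (-(1 - α / β)) * g ξ (s ^ (α / β)), fun r hr => ?_, ?_, ?_, ?_⟩
  · exact (hmeas _ (Real.rpow_pos_of_pos hr _)).const_mul _
  · filter_upwards [hcm] with ξ hξ
    exact hξ.rpow_mul_comp_rpow (sub_nonneg.2 hq1) (by positivity) hq1
  · filter_upwards [hκ] with ξ hξ
    rw [hξ]
    congr 1
    ext r
    have hr : (0 : ℝ) < r := r.2
    rw [hgr ξ r hr, ← mul_assoc, ← Real.rpow_add hr]
    ring_nf
  · filter_upwards [hint] with ξ hξ
    refine lt_of_eq_of_lt (setLIntegral_congr_fun measurableSet_Ioi fun r hr => ?_) hξ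
    have hr : (0 : ℝ) < r := hr
    -- The factor `r^{α-β}` passes inside the minimum, so the two integrands agree pointwise.
    rw [hgr ξ r hr, ← mul_assoc, min_mul_of_nonneg _ _ (Real.rpow_nonneg hr.le _),
      ← Real.rpow_add hr, ← Real.rpow_add hr]
    ring_nf

end InfDiv

theorem theorem3p2 (d : ℕ) (α β : ℝ) (hα : 0 < α) (hαβ : α < β) :
    InfDiv.classE α d ⊆ InfDiv.classE β d := by
  rintro μ ⟨hμ, A, ν, γ, htrip, hν⟩
  refine ⟨hμ, A, ν, γ, htrip, hν.imp_right ?_⟩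
  rintro ⟨hne, lam, κ, hpol, hrad⟩
  exact ⟨hne, lam, κ, hpol, hrad.mono hα hαβ.le⟩
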